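/- Let $G,H,E,F$ be real Banach spaces, let $X\subseteq G$ and $Y\subseteq H$ be open, and let $1\le p\le\infty$, $0\le q\le\infty$. For $k\in\mathbb N\cup\{0\}$ let $D^k$ denote the $k$-th Fréchet derivative. $C^p(X,E)$ is the vector space of all $p$ times continuously (Fréchet) differentiable functions $f:X\to E$, with the locally convex topology generated by the seminorms $$\rho_{K,k}(f)=\sup_{x\in K}\ \sup_{0\le j\le k}\|D^jf(x)\|,\qquad K\subseteq X\text{ compact},\ k\in\mathbb N\cup\{0\},\ k\le p;$$ $C^q(Y,F)$ is defined and topologized in the same way. Assume that there is a bump function $\varphi\in C^p(G,\mathbb R)$ with $\varphi(x)=1$ if $\|x\|\le 1/2$, $\varphi(x)=0$ if $\|x\|\ge 1$, and $\sup_{x\in G}\|D^k\varphi(x)\|<\infty$ for all $k\in\mathbb N\cup\{0\}$ with $k\le p$. A linear operator $T:C^p(X,E)\to C^q(Y,F)$ is called *separating* if for all $f_1,f_2\in C^p(X,E)$ such that for every $x\in X$ either $f_1(x)=0$ or $f_2(x)=0$, one has for every $y\in Y$ either $Tf_1(y)=0$ or $Tf_2(y)=0$. It is called *nowhere trivial*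 if for every $y\in Y$ there is $f\in C^p(X,E)$ with $Tf(y)\ne0$. Put $A=C^p(X,\mathbb R)$, let $\mathbb R_\infty$ be the one-point compactification of $\mathbb R$, define $i:X\to\mathbb R_\infty^{A}$ by $i(x)(\psi)=\psi(x)$, and let $\mathcal AX$ be the closure of $i(X)$ in $\mathbb R_\infty^{A}$. For $f\in C^p(X,E)$ let $\overline C(f)$ be the closure of $i(\{x\in X: f(x)\neq 0\})$ in $\mathcal AX$. A *support map* of $T$ is a continuous map $h:\widetilde Y\to\mathcal AX$, where $\widetilde Y=\{y\in Y: Tf(y)\ne0\text{ for some }f\in C^p(X,E)\}$, such that $Tf(y)=0$ whenever $f\in C^p(X,E)$, $y\in\widetilde Y$ and $h(y)\notin\overline C(f)$. **Corollary.** Let $T:C^p(X,E)\to C^q(Y,F)$ be a continuous, separating, nowhere trivial linear operator (so that $\widetilde Y=Y$), and suppose that $q>p$. Then $T$ has exactly one support map; it takes its values in $i(X)$, that is, it is of the form $y\mapsto i(h(y))$ for a map $h:Y\to X$; and there is a partition of $Y$ into clopen subsets $(Y_\alpha)$ such that $h$ is constant on each $Y_\alpha$. -/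

import Mathlib

open Set TopologicalSpace

noncomputable section

section Space

variable {G : Type*} [NormedAddCommGroup G] [NormedSpace ℝ G]
variable {E : Type*} [NormedAddCommGroup E] [NormedSpace ℝ E]

/-- Extension by `0` of a function on the open set `X` to the whole space. Only its germs at
points of `X` are ever used, and these do not depend on the values outside `X`. -/
def extendZero {X : Opens G} (f : X → E) : G → E :=
  Function.extend (Subtype.val : X → G) f 0

theorem extendZero_add {X : Opens G} (f g : X → E) :
    extendZero (f + g) = extendZero f + extendZero g := by
  have h := Function.extend_add (Subtype.val : X → G) f g 0 0
  rwa [add_zero] at h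

theorem extendZero_smul {X : Opens G} (c : ℝ) (f : X → E) :
    extendZero (c • f) = c • extendZero f := by
  have h := Function.extend_smul c (Subtype.val : X → G) f 0
  rwa [smul_zero] at h

theorem extendZero_zero {X : Opens G} : extendZero (0 : X → E) = 0 :=
  Function.extend_zero _

/-- The vector space of `p` times continuously differentiable functions `X → E`. -/
def diffSubmodule (p : ℕ∞) (X : Opens G) (E : Type*) [NormedAddCommGroup E] [NormedSpace ℝ E] :
    Submodule ℝ (X → E) where
  carrier := {f | ContDiffOn ℝ p (extendZero f) (X : Set G)}
  add_mem' := by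
    intro f g hf hg
    change ContDiffOn ℝ p (extendZero (f + g)) (X : Set G)
    rw [extendZero_add]
    exact ContDiffOn.add hf hg
  zero_mem' := by
    change ContDiffOn ℝ p (extendZero (0 : X → E)) (X : Set G)
    rw [extendZero_zero]
    exact contDiffOn_const
  smul_mem' := by
    intro c f hf
    change ContDiffOn ℝ p (extendZero (c • f)) (X : Set G)
    rw [extendZero_smul]
    exact ContDiffOn.const_smul c hf

/-- The space `C^p(X, E)`, `X` open in the normed space `G`. It is a type of its own, so that it
does not inherit the topology of pointwise convergence. -/
def CDiff (p : ℕ∞) (X : Opens G) (E : Type*) [NormedAddCommGroup E] [NormedSpace ℝ E] :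
    Type _ :=
  diffSubmodule p X E

namespace CDiff

instance (p : ℕ∞) (X : Opens G) : AddCommGroup (CDiff p X E) :=
  inferInstanceAs (AddCommGroup (diffSubmodule p X E))

instance (p : ℕ∞) (X : Opens G) : Module ℝ (CDiff p X E) :=
  inferInstanceAs (Module ℝ (diffSubmodule p X E))

instance (p : ℕ∞) (X : Opens G) : CoeFun (CDiff p X E) (fun _ => X → E) :=
  ⟨fun f => Subtype.val f⟩

/-- The `k`-th Fréchet derivative `D^k f(x)`, for `x ∈ X`. -/
def derivAt {p : ℕ∞} {X : Opens G} (k : ℕ) (f : CDiff p X E) (x : X) : G [×k]→L[ℝ] E :=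
  iteratedFDeriv ℝ k (extendZero f) (x : G)

theorem contDiffAt {p : ℕ∞} {X : Opens G} (f : CDiff p X E) (x : X) :
    ContDiffAt ℝ p (extendZero f) (x : G) :=
  ContDiffOn.contDiffAt f.2 (X.isOpen.mem_nhds x.2)

theorem continuous_derivAt {p : ℕ∞} {X : Opens G} {k : ℕ} (hk : (k : ℕ∞) ≤ p)
    (f : CDiff p X E) : Continuous (derivAt k f) := by
  rw [continuous_iff_continuousAt]
  intro x
  have h : ContDiffAt ℝ k (extendZero f) (x : G) := (contDiffAt f x).of_le (by exact_mod_cast hk)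
  have h2 : ContinuousAt (iteratedFDeriv ℝ k (extendZero f)) (x : G) :=
    (h.iteratedFDeriv_right (m := 0) (i := k) (by simp)).continuousAt
  exact h2.comp continuous_subtype_val.continuousAt

theorem derivAt_add {p : ℕ∞} {X : Opens G} {k : ℕ} (hk : (k : ℕ∞) ≤ p)
    (f g : CDiff p X E) (x : X) : derivAt k (f + g) x = derivAt k f x + derivAt k g x := by
  have hf : ContDiffAt ℝ k (extendZero f) (x : G) := (contDiffAt f x).of_le (by exact_mod_cast hk)
  have hg : ContDiffAt ℝ k (extendZero g) (x : G) := (contDiffAt g x).of_le (by exact_mod_cast hk)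
  have h : extendZero (f + g : CDiff p X E) = extendZero f + extendZero g := extendZero_add _ _
  rw [derivAt, h]
  exact iteratedFDeriv_add_apply hf hg

theorem derivAt_smul {p : ℕ∞} {X : Opens G} {k : ℕ} (hk : (k : ℕ∞) ≤ p)
    (c : ℝ) (f : CDiff p X E) (x : X) : derivAt k (c • f) x = c • derivAt k f x := by
  have hf : ContDiffAt ℝ k (extendZero f) (x : G) := (contDiffAt f x).of_le (by exact_mod_cast hk)
  have h : extendZero (c • f : CDiff p X E) = c • extendZero f := extendZero_smul _ _
  rw [derivAt, h]
  exact iteratedFDeriv_const_smul_apply hf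

theorem bddAbove_derivAt {p : ℕ∞} {X : Opens G} (K : Compacts X) {k : ℕ} (hk : (k : ℕ∞) ≤ p)
    (f : CDiff p X E) :
    BddAbove (range fun z : K × {j : ℕ // j ≤ k} => ‖derivAt z.2.1 f z.1.1‖) := by
  have hj : ∀ j : {j : ℕ // j ≤ k}, BddAbove ((fun x : X => ‖derivAt j.1 f x‖) '' K) := fun j =>
    K.isCompact.bddAbove_image
      (continuous_derivAt (le_trans (by exact_mod_cast j.2) hk) f).norm.continuousOn
  choose C hC using hj
  have : Finite {j : ℕ // j ≤ k} := (Set.finite_Iic k).to_subtype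
  obtain ⟨M, hM⟩ := (Set.finite_range C).bddAbove
  refine ⟨M, ?_⟩
  rintro _ ⟨⟨x, j⟩, rfl⟩
  exact (hC j ⟨x.1, x.2, rfl⟩).trans (hM ⟨j, rfl⟩)

/-- The seminorm `ρ_{K,k}(f) = sup_{x ∈ K} sup_{0 ≤ j ≤ k} ‖D^j f(x)‖`, for `K ⊆ X` compact
and `k ≤ p`. -/
def rho {p : ℕ∞} {X : Opens G} (K : Compacts X) (k : {k : ℕ // (k : ℕ∞) ≤ p}) :
    Seminorm ℝ (CDiff p X E) :=
  Seminorm.of (fun f => ⨆ z : K × {j : ℕ // j ≤ k.1}, ‖derivAt z.2.1 f z.1.1‖)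
    (by
      intro f g
      refine Real.iSup_le (fun z => ?_)
        (add_nonneg (Real.iSup_nonneg fun _ => norm_nonneg _)
          (Real.iSup_nonneg fun _ => norm_nonneg _))
      rw [derivAt_add (le_trans (by exact_mod_cast z.2.2) k.2)]
      exact (norm_add_le _ _).trans
        (add_le_add (le_ciSup (bddAbove_derivAt K k.2 f) z)
          (le_ciSup (bddAbove_derivAt K k.2 g) z)))
    (by
      intro c f
      rw [Real.mul_iSup_of_nonneg (norm_nonneg c)]
      refine iSup_congr fun z => ?_
      rw [derivAt_smul (le_trans (by exact_mod_cast z.2.2) k.2), norm_smul])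

/-- The family of all seminorms `ρ_{K,k}`. -/
def rhoFamily (p : ℕ∞) (X : Opens G) (E : Type*) [NormedAddCommGroup E] [NormedSpace ℝ E] :
    SeminormFamily ℝ (CDiff p X E) (Compacts X × {k : ℕ // (k : ℕ∞) ≤ p}) :=
  fun i => rho i.1 i.2

/-- The locally convex topology of `C^p(X, E)` generated by the seminorms `ρ_{K,k}`. -/
instance (p : ℕ∞) (X : Opens G) : TopologicalSpace (CDiff p X E) :=
  (rhoFamily p X E).moduleFilterBasis.topology

/-- Disjointness of two functions. -/
def Disj {p : ℕ∞} {X : Opens G} (f₁ f₂ : CDiff p X E) : Prop :=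
  ∀ x : X, f₁ x = 0 ∨ f₂ x = 0

end CDiff

/-- A `C^p` bump function on `G` with bounded derivatives of all orders `k ≤ p`. -/
def HasBumpFunction (p : ℕ∞) (G : Type*) [NormedAddCommGroup G] [NormedSpace ℝ G] : Prop :=
  ∃ φ : G → ℝ, ContDiff ℝ p φ ∧ (∀ x, ‖x‖ ≤ 1 / 2 → φ x = 1) ∧ (∀ x, 1 ≤ ‖x‖ → φ x = 0) ∧
    ∀ k : ℕ, (k : ℕ∞) ≤ p → ∃ C : ℝ, ∀ x, ‖iteratedFDeriv ℝ k φ x‖ ≤ C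

/-- The map `i : X → ℝ_∞^{A(X)}`, `i(x)(φ) = φ(x)`, where `A(X) = C^p(X, ℝ)` and `ℝ_∞` is the
one-point compactification of `ℝ`. -/
def evalCube (p : ℕ∞) (X : Opens G) (x : X) : CDiff p X ℝ → OnePoint ℝ :=
  fun φ => ((φ x : ℝ) : OnePoint ℝ)

/-- The `C^p(X, ℝ)`-compactification of `X`: the closure of `i(X)` in `ℝ_∞^{A(X)}`. -/
abbrev Compactif (p : ℕ∞) (X : Opens G) : Type _ :=
  closure (range (evalCube p X))

/-- The embedding `i` of `X` into its compactification. -/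
def toCompactif (p : ℕ∞) (X : Opens G) (x : X) : Compactif p X :=
  ⟨evalCube p X x, subset_closure (mem_range_self x)⟩

/-- The closure, in the compactification, of `i({x | f x ≠ 0})`. -/
def closedSupport {p : ℕ∞} {X : Opens G} (f : CDiff p X E) : Set (Compactif p X) :=
  closure (toCompactif p X '' {x | f x ≠ 0})

end Space

section Operator

variable {G : Type*} [NormedAddCommGroup G] [NormedSpace ℝ G]
variable {H : Type*} [NormedAddCommGroup H] [NormedSpace ℝ H]
variable {E : Type*} [NormedAddCommGroup E] [NormedSpace ℝ E]
variable {F : Type*} [NormedAddCommGroup F] [NormedSpace ℝ F]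
variable {p q : ℕ∞} {X : Opens G} {Y : Opens H}

/-- `T` is separating (disjointness preserving). -/
def IsSeparating (T : CDiff p X E →ₗ[ℝ] CDiff q Y F) : Prop :=
  ∀ f₁ f₂ : CDiff p X E, f₁.Disj f₂ → (T f₁).Disj (T f₂)

/-- The set of all `y ∈ Y` at which `T f` does not vanish for some `f`. -/
def nontrivialSet (T : CDiff p X E →ₗ[ℝ] CDiff q Y F) : Set Y :=
  {y | ∃ f : CDiff p X E, T f y ≠ 0}

/-- `T` is nowhere trivial. -/
def IsNowhereTrivial (T : CDiff p X E →ₗ[ℝ] CDiff q Y F) : Prop :=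
  ∀ y : Y, ∃ f : CDiff p X E, T f y ≠ 0

/-- `h` is a support map of `T`: a continuous map from `{y | ∃ f, T f y ≠ 0}` into the
compactification of `X` such that `T f y = 0` whenever `h y` is not in the closed support
of `f`. -/
structure IsSupportMap (T : CDiff p X E →ₗ[ℝ] CDiff q Y F)
    (h : nontrivialSet T → Compactif p X) : Prop where
  continuous : Continuous h
  eq_zero : ∀ (f : CDiff p X E) (y : nontrivialSet T), h y ∉ closedSupport f → T f y.1 = 0

end Operator

end

/-!
A continuous functional `f ↦ T f y` sees only the derivatives of `f` on a compact set. If no point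
of `X` supported it, then near each point `f` could be cut off without changing `T f y`, because
`T` is separating; finitely many cutoffs would make `f` vanish near the compact set, so `T f y`
would always be `0`. This gives a support point `h y`.

Let `p < q`. If `r < dist (h w) (h y)`, cut `f` off by a bump `ψ` of radius `r ≤ 1` around `h y`.
The seminorms of `ψ • f` are of order at most `r⁻ᵖ`, and `T (ψ • f)` vanishes near `w` but agrees
with `T f` at `y`. Taylor's formula of order `p + 1` along the segment from `w` to `y` gives
`rᵖ = O(‖w - y‖ᵖ⁺¹)`. So `h` has derivative zero along segments and is locally constant.
-/

open Filter Topology Function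

section Segment

variable {V : Type*} [NormedAddCommGroup V] [NormedSpace ℝ V]
variable {W : Type*} [NormedAddCommGroup W] [NormedSpace ℝ W]

theorem norm_le_of_norm_fderiv_le_pow {g : V → W} {a b : V} {M : ℝ} {k : ℕ} (hM₀ : 0 ≤ M)
    (hg : ∀ z ∈ segment ℝ a b, DifferentiableAt ℝ g z) (ha : g a = 0)
    (hM : ∀ z ∈ segment ℝ a b, ‖fderiv ℝ g z‖ ≤ M * ‖z - a‖ ^ k) :
    ‖g b‖ ≤ M * ‖b - a‖ ^ (k + 1) := by
  have hbound : ∀ z ∈ segment ℝ a b, ‖fderiv ℝ g z‖ ≤ M * ‖b - a‖ ^ k := fun z hz =>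
    (hM z hz).trans <| by gcongr; exact norm_sub_le_of_mem_segment hz
  have hmv := (convex_segment a b).norm_image_sub_le_of_norm_fderiv_le hg hbound
    (left_mem_segment ℝ a b) (right_mem_segment ℝ a b)
  rwa [ha, sub_zero, mul_assoc, ← pow_succ] at hmv

theorem norm_le_of_iteratedFDeriv_eq_zero {g : V → W} {a b : V} {M : ℝ} {N : ℕ}
    (hg : ∀ z ∈ segment ℝ a b, ContDiffAt ℝ N g z) (ha : ∀ j < N, iteratedFDeriv ℝ j g a = 0)
    (hM : ∀ z ∈ segment ℝ a b, ‖iteratedFDeriv ℝ N g z‖ ≤ M) :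
    ‖g b‖ ≤ M * ‖b - a‖ ^ N := by
  have hM₀ : 0 ≤ M := (norm_nonneg _).trans (hM a (left_mem_segment ℝ a b))
  have hderiv : ∀ k j : ℕ, j + k = N → ∀ z ∈ segment ℝ a b,
      ‖iteratedFDeriv ℝ j g z‖ ≤ M * ‖z - a‖ ^ k := by
    intro k
    induction k with
    | zero =>
      rintro j rfl z hz
      simpa using hM z hz
    | succ k ih =>
      intro j hj z hz
      have hsub : segment ℝ a z ⊆ segment ℝ a b :=
        (convex_segment a b).segment_subset (left_mem_segment ℝ a b) hz
      have hjN : j < N := by lia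
      refine norm_le_of_norm_fderiv_le_pow hM₀ (fun w hw => ?_) (ha j hjN) fun w hw => ?_
      · exact (hg w (hsub hw)).differentiableAt_iteratedFDeriv (by exact_mod_cast hjN)
      · rw [norm_fderiv_iteratedFDeriv]
        exact ih (j + 1) (by lia) w (hsub hw)
  simpa only [norm_iteratedFDeriv_zero] using
    hderiv N 0 (zero_add N) b (right_mem_segment ℝ a b)

theorem hasFDerivWithinAt_zero_of_norm_pow_le {d : V → W} {s : Set V} {y : V} {m l : ℕ}
    (hml : m < l) {C : ℝ}
    (hd : ∀ᶠ w in 𝓝[s] y, d w ≠ d y → ‖d w - d y‖ ^ m ≤ C * ‖w - y‖ ^ l) :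
    HasFDerivWithinAt d (0 : V →L[ℝ] W) s y := by
  rw [hasFDerivWithinAt_iff_isLittleO, Asymptotics.isLittleO_iff]
  intro ε hε
  have hlim : Tendsto (fun w => C * ‖w - y‖ ^ (l - m)) (𝓝[s] y) (𝓝 0) := by
    have hcont : Continuous fun w => C * ‖w - y‖ ^ (l - m) := by fun_prop
    simpa [Nat.sub_ne_zero_of_lt hml] using (hcont.tendsto y).mono_left nhdsWithin_le_nhds
  filter_upwards [hd, hlim.eventually_lt_const (pow_pos hε m)] with w hw hwε
  rw [_root_.zero_apply, sub_zero]
  by_contra! hlt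
  have hdw : d w ≠ d y := fun h => by
    rw [h, sub_self, norm_zero] at hlt
    exact hlt.not_ge (by positivity)
  have hwy : 0 < ‖w - y‖ := norm_pos_iff.2 (sub_ne_zero.2 (ne_of_apply_ne d hdw))
  refine lt_irrefl (‖d w - d y‖ ^ m) ?_
  calc ‖d w - d y‖ ^ m ≤ C * ‖w - y‖ ^ l := hw hdw
    _ = C * ‖w - y‖ ^ (l - m) * ‖w - y‖ ^ m := by
      rw [mul_assoc, ← pow_add, Nat.sub_add_cancel hml.le]
    _ < ε ^ m * ‖w - y‖ ^ m := by gcongr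
    _ = (ε * ‖w - y‖) ^ m := (mul_pow _ _ _).symm
    _ ≤ ‖d w - d y‖ ^ m := by gcongr

theorem eq_of_hasFDerivWithinAt_segment_zero {d : V → W} {a b : V}
    (hd : ∀ y ∈ segment ℝ a b, HasFDerivWithinAt d (0 : V →L[ℝ] W) (segment ℝ a b) y) :
    d b = d a := by
  have hmv := (convex_segment a b).norm_image_sub_le_of_norm_hasFDerivWithin_le hd
    (fun _ _ => norm_zero.le) (left_mem_segment ℝ a b) (right_mem_segment ℝ a b)
  rwa [zero_mul, norm_le_zero_iff, sub_eq_zero] at hmv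

theorem isLocallyConstant_of_dist_pow_le_on_segments {S : Type*} [TopologicalSpace S] {e : S → V}
    (he : IsOpenEmbedding e) {h : S → W} {m l : ℕ} (hml : m < l)
    (hd : ∀ a b : V, segment ℝ a b ⊆ range e → ∃ C : S → ℝ, ∀ y, e y ∈ segment ℝ a b →
      ∀ᶠ w in 𝓝 y, e w ∈ segment ℝ a b → h w ≠ h y →
        dist (h w) (h y) ^ m ≤ C y * dist (e w) (e y) ^ l) :
    IsLocallyConstant h := by
  rw [IsLocallyConstant.iff_eventually_eq]
  intro y₀
  obtain ⟨ε, hε, hball⟩ := Metric.isOpen_iff.1 he.isOpen_range (e y₀) (mem_range_self y₀)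
  filter_upwards [he.continuous.continuousAt.eventually (Metric.ball_mem_nhds (e y₀) hε)]
    with y₁ hy₁
  have hseg : segment ℝ (e y₀) (e y₁) ⊆ range e :=
    ((convex_ball (e y₀) ε).segment_subset (Metric.mem_ball_self hε) hy₁).trans hball
  obtain ⟨C, hC⟩ := hd _ _ hseg
  have hext : ∀ y, extend e h 0 (e y) = h y := he.injective.extend_apply h 0
  rw [← hext y₁, ← hext y₀]
  refine eq_of_hasFDerivWithinAt_segment_zero fun z hz => ?_
  obtain ⟨y, rfl⟩ := hseg hz
  refine hasFDerivWithinAt_zero_of_norm_pow_le hml (C := C y) ?_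
  rw [eventually_nhdsWithin_iff, ← he.map_nhds_eq, eventually_map]
  filter_upwards [hC y hz] with w hw
  simpa only [hext, dist_eq_norm] using hw

end Segment

theorem exists_isPartition_isClopen_of_isLocallyConstant {S R : Type*} [TopologicalSpace S]
    {h : S → R} (hh : IsLocallyConstant h) :
    ∃ P : Set (Set S), Setoid.IsPartition P ∧
      ∀ s ∈ P, IsClopen s ∧ ∃ x, ∀ y ∈ s, h y = x := by
  refine ⟨(Setoid.ker h).classes, Setoid.isPartition_classes _, ?_⟩
  rintro _ ⟨y, rfl⟩
  exact ⟨hh.isClopen_fiber (h y), h y, fun _ hz => hz⟩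

section ExtendZero

variable {G : Type*} [NormedAddCommGroup G] {E : Type*} [NormedAddCommGroup E] {X : Opens G}

theorem extendZero_apply (f : X → E) (x : X) : extendZero f (x : G) = f x :=
  Subtype.val_injective.extend_apply f 0 x

theorem extendZero_comp_val_eqOn (g : G → E) : EqOn (extendZero fun x : X => g x) g X :=
  fun x hx => extendZero_apply (fun x : X => g x) ⟨x, hx⟩

theorem extendZero_fun_smul [NormedSpace ℝ E] (ψ : X → ℝ) (f : X → E) :
    extendZero (fun x => ψ x • f x) = fun z => extendZero ψ z • extendZero f z := by
  funext z
  by_cases hz : z ∈ X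
  · lift z to X using hz
    simp only [extendZero_apply]
  · have hz' : ¬∃ a : X, (a : G) = z := fun ⟨a, ha⟩ => hz (ha ▸ a.2)
    simp only [extendZero, extend_apply' _ _ _ hz', Pi.zero_apply, smul_zero]

end ExtendZero

section Functions

variable {G : Type*} [NormedAddCommGroup G] [NormedSpace ℝ G]
variable {E : Type*} [NormedAddCommGroup E] [NormedSpace ℝ E]
variable {p : ℕ∞} {X : Opens G}

namespace CDiff

protected theorem continuous (f : CDiff p X E) : Continuous (f : X → E) := by
  have hcont : Continuous fun x : X => extendZero f (x : G) :=
    continuous_iff_continuousAt.2 fun x =>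
      (contDiffAt f x).continuousAt.comp continuous_subtype_val.continuousAt
  simpa only [extendZero_apply] using hcont

theorem sub_apply (f g : CDiff p X E) (x : X) : (f - g) x = f x - g x := rfl

/-- The pointwise product of a function in `C^p(X, ℝ)` and a function in `C^p(X, E)`. -/
instance : SMul (CDiff p X ℝ) (CDiff p X E) where
  smul ψ f := ⟨fun x => ψ x • f x, by
    change ContDiffOn ℝ p (extendZero fun x => ψ x • f x) X
    rw [extendZero_fun_smul]
    exact ψ.2.smul f.2⟩

theorem smul_apply (ψ : CDiff p X ℝ) (f : CDiff p X E) (x : X) : (ψ • f) x = ψ x • f x := rfl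

/-- The restriction to `X` of a `C^p` function on the whole space. -/
def restrict (X : Opens G) (g : G → E) (hg : ContDiff ℝ p g) : CDiff p X E :=
  ⟨fun x => g x, hg.contDiffOn.congr (extendZero_comp_val_eqOn g)⟩

theorem derivAt_restrict {g : G → E} (hg : ContDiff ℝ p g) (j : ℕ) (x : X) :
    derivAt j (restrict X g hg) x = iteratedFDeriv ℝ j g x :=
  (((extendZero_comp_val_eqOn g).eventuallyEq_of_mem
    (X.isOpen.mem_nhds x.2)).iteratedFDeriv ℝ j).self_of_nhds

theorem norm_derivAt_zero (f : CDiff p X E) (x : X) : ‖derivAt 0 f x‖ = ‖f x‖ := by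
  rw [derivAt, norm_iteratedFDeriv_zero, extendZero_apply]

theorem derivAt_eq_zero_of_notMem_tsupport {f : CDiff p X E} {x : X}
    (hx : x ∉ tsupport (f : X → E)) (k : ℕ) : derivAt k f x = 0 := by
  have hzero : extendZero f =ᶠ[𝓝 (x : G)] 0 := by
    rw [EventuallyEq, ← X.isOpen.isOpenEmbedding_subtypeVal.map_nhds_eq x, eventually_map]
    filter_upwards [notMem_tsupport_iff_eventuallyEq.1 hx] with z hz
    exact (extendZero_apply f z).trans hz
  rw [derivAt, (hzero.iteratedFDeriv ℝ k).self_of_nhds, iteratedFDeriv_zero, Pi.zero_apply]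

theorem norm_derivAt_smul_le (ψ : CDiff p X ℝ) (f : CDiff p X E) {j : ℕ} (hj : (j : ℕ∞) ≤ p)
    (x : X) :
    ‖derivAt j (ψ • f) x‖ ≤ ∑ i ∈ Finset.range (j + 1),
      (j.choose i : ℝ) * ‖derivAt i ψ x‖ * ‖derivAt (j - i) f x‖ := by
  have hleibniz := norm_iteratedFDerivWithin_smul_le ψ.2 f.2 X.isOpen.uniqueDiffOn x.2 (n := j)
    (by exact_mod_cast hj)
  simp only [iteratedFDerivWithin_of_isOpen _ X.isOpen x.2] at hleibniz
  rw [derivAt, show extendZero (ψ • f : CDiff p X E) = _ from extendZero_fun_smul ψ f]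
  exact hleibniz

theorem norm_derivAt_le_rho {K : Compacts X} {k : {k : ℕ // (k : ℕ∞) ≤ p}} (f : CDiff p X E)
    {j : ℕ} (hj : j ≤ k.1) {x : X} (hx : x ∈ K) : ‖derivAt j f x‖ ≤ rho K k f :=
  le_ciSup (bddAbove_derivAt K k.2 f) (⟨⟨x, hx⟩, ⟨j, hj⟩⟩ : K × {j : ℕ // j ≤ k.1})

theorem rho_le {K : Compacts X} {k : {k : ℕ // (k : ℕ∞) ≤ p}} {f : CDiff p X E} {B : ℝ}
    (hB : 0 ≤ B) (hf : ∀ x ∈ K, ∀ j ≤ k.1, ‖derivAt j f x‖ ≤ B) : rho K k f ≤ B :=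
  Real.iSup_le (fun z => hf z.1 z.1.2 z.2 z.2.2) hB

theorem monotone_rhoFamily : Monotone (rhoFamily p X E) := fun _ _ hij f =>
  rho_le (apply_nonneg _ f) fun _ hx _ hj =>
    norm_derivAt_le_rho f (hj.trans hij.2) (hij.1 hx)

theorem rho_eq_zero_of_disjoint_tsupport {K : Compacts X} (k : {k : ℕ // (k : ℕ∞) ≤ p})
    {f : CDiff p X E} (hf : Disjoint (K : Set X) (tsupport (f : X → E))) : rho K k f = 0 :=
  (rho_le le_rfl fun x hx j _ => by
    rw [derivAt_eq_zero_of_notMem_tsupport (disjoint_left.1 hf hx), norm_zero]).antisymm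
    (apply_nonneg _ f)

theorem rho_smul_le (K : Compacts X) (k : {k : ℕ // (k : ℕ∞) ≤ p}) (ψ : CDiff p X ℝ)
    (f : CDiff p X E) : rho K k (ψ • f) ≤ 2 ^ k.1 * rho K k ψ * rho K k f := by
  refine rho_le (by positivity) fun x hx j hj => ?_
  calc ‖derivAt j (ψ • f) x‖
      ≤ ∑ i ∈ Finset.range (j + 1),
          (j.choose i : ℝ) * ‖derivAt i ψ x‖ * ‖derivAt (j - i) f x‖ :=
        norm_derivAt_smul_le ψ f ((Nat.cast_le.2 hj).trans k.2) x
    _ ≤ ∑ i ∈ Finset.range (j + 1), (j.choose i : ℝ) * rho K k ψ * rho K k f := by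
        refine Finset.sum_le_sum fun i hi => ?_
        have hij : i ≤ j := Finset.mem_range_succ_iff.1 hi
        gcongr
        · exact norm_derivAt_le_rho ψ (hij.trans hj) hx
        · exact norm_derivAt_le_rho f ((Nat.sub_le j i).trans hj) hx
    _ = 2 ^ j * rho K k ψ * rho K k f := by
        rw [← Finset.sum_mul, ← Finset.sum_mul, ← Nat.cast_sum, Nat.sum_range_choose,
          Nat.cast_pow, Nat.cast_ofNat]
    _ ≤ 2 ^ k.1 * rho K k ψ * rho K k f := by
        gcongr
        exact one_le_two

theorem withSeminorms_rhoFamily : WithSeminorms (rhoFamily p X E) := ⟨rfl⟩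

theorem norm_le_of_notMem_tsupport (f : CDiff p X E) {N : ℕ} (hN : (N : ℕ∞) ≤ p) {a b : X}
    (ha : a ∉ tsupport (f : X → E)) {s : Set X} (hs : segment ℝ (a : G) b ⊆ (↑) '' s) {M : ℝ}
    (hM : ∀ z ∈ s, ‖derivAt N f z‖ ≤ M) : ‖f b‖ ≤ M * ‖(b : G) - a‖ ^ N := by
  rw [← extendZero_apply f b]
  refine norm_le_of_iteratedFDeriv_eq_zero (fun z hz => ?_)
    (fun j _ => derivAt_eq_zero_of_notMem_tsupport ha j) fun z hz => ?_
  all_goals obtain ⟨z, hzs, rfl⟩ := hs hz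
  · exact (contDiffAt f z).of_le (by exact_mod_cast hN)
  · exact hM z hzs

end CDiff

theorem continuous_toCompactif (p : ℕ∞) (X : Opens G) : Continuous (toCompactif p X) :=
  Continuous.subtype_mk
    (continuous_pi fun φ => OnePoint.continuous_coe.comp (CDiff.continuous φ)) _

namespace HasBumpFunction

theorem exists_scaled (hb : HasBumpFunction p G) (n : ℕ) (hn : (n : ℕ∞) ≤ p) :
    ∃ B : ℝ, ∀ (x : G) (r : ℝ), 0 < r → ∃ ψ : G → ℝ, ContDiff ℝ p ψ ∧
      EqOn ψ 1 (Metric.closedBall x (r / 2)) ∧ tsupport ψ ⊆ Metric.closedBall x r ∧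
      ∀ j ≤ n, ∀ z, ‖iteratedFDeriv ℝ j ψ z‖ ≤ B * r⁻¹ ^ j := by
  obtain ⟨φ, hφ, hone, hzero, hbdd⟩ := hb
  have hle : ∀ j ≤ n, (j : ℕ∞) ≤ p := fun j hj => (Nat.cast_le.2 hj).trans hn
  obtain ⟨B, hB⟩ : ∃ B : ℝ, ∀ j ≤ n, ∀ z, ‖iteratedFDeriv ℝ j φ z‖ ≤ B := by
    choose! C hC using hbdd
    obtain ⟨B, hB⟩ := ((finite_Iic n).image C).bddAbove
    exact ⟨B, fun j hj z => (hC j (hle j hj) z).trans (hB (mem_image_of_mem C hj))⟩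
  refine ⟨B, fun x r hr => ⟨fun z => φ (r⁻¹ • (z - x)), by fun_prop, fun z hz => hone _ ?_,
    closure_minimal (fun z hz => ?_) Metric.isClosed_closedBall, fun j hj z => ?_⟩⟩
  · rw [norm_smul_of_nonneg (by positivity), ← dist_eq_norm, inv_mul_le_iff₀ hr]
    linarith [Metric.mem_closedBall.1 hz]
  · have hlt : ‖r⁻¹ • (z - x)‖ < 1 := not_le.1 fun h => hz (hzero _ h)
    rw [norm_smul_of_nonneg (by positivity), ← dist_eq_norm, inv_mul_lt_iff₀ hr, mul_one] at hlt
    exact hlt.le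
  · rw [iteratedFDeriv_comp_sub (f := fun z => φ (r⁻¹ • z)) j x z,
      iteratedFDeriv_comp_const_smul r⁻¹ (hφ.of_le (by exact_mod_cast hle j hj)), norm_smul,
      Real.norm_of_nonneg (by positivity), mul_comm]
    gcongr
    exact hB j hj _

theorem exists_cutoff_rho_le (hb : HasBumpFunction p G) (k : {k : ℕ // (k : ℕ∞) ≤ p}) :
    ∃ B : ℝ, ∀ (x : X) (r : ℝ), 0 < r → ∃ ψ : CDiff p X ℝ, ψ =ᶠ[𝓝 x] 1 ∧
      tsupport (ψ : X → ℝ) ⊆ Metric.closedBall x r ∧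
      (r ≤ 1 → ∀ K : Compacts X, CDiff.rho K k ψ ≤ B * r⁻¹ ^ k.1) := by
  obtain ⟨B, hB⟩ := hb.exists_scaled k.1 k.2
  refine ⟨B, fun x r hr => ?_⟩
  obtain ⟨ψ, hψ, hone, hsupp, hderiv⟩ := hB x r hr
  have hB₀ : 0 ≤ B := by
    simpa only [pow_zero, mul_one] using (norm_nonneg _).trans (hderiv 0 (Nat.zero_le _) (x : G))
  refine ⟨CDiff.restrict X ψ hψ, ?_, ?_, fun hr₁ K => ?_⟩
  · filter_upwards [Metric.closedBall_mem_nhds x (half_pos hr)] with z hz using hone hz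
  · exact closure_minimal (fun z hz => hsupp (subset_tsupport ψ hz)) Metric.isClosed_closedBall
  · refine CDiff.rho_le (by positivity) fun z _ j hj => ?_
    rw [CDiff.derivAt_restrict]
    refine (hderiv j hj z).trans ?_
    gcongr
    exact (one_le_inv₀ hr).2 hr₁

theorem exists_cutoff (hb : HasBumpFunction p G) {x : X} {U : Set X} (hU : U ∈ 𝓝 x) :
    ∃ ψ : CDiff p X ℝ, ψ =ᶠ[𝓝 x] 1 ∧ tsupport (ψ : X → ℝ) ⊆ U := by
  obtain ⟨r, hr, hrU⟩ := Metric.nhds_basis_closedBall.mem_iff.1 hU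
  obtain ⟨B, hB⟩ := hb.exists_cutoff_rho_le (X := X) ⟨0, zero_le⟩
  obtain ⟨ψ, hone, hsupp, -⟩ := hB x r hr
  exact ⟨ψ, hone, hsupp.trans hrU⟩

end HasBumpFunction

end Functions

section SupportPoint

variable {G : Type*} [NormedAddCommGroup G] [NormedSpace ℝ G]
variable {H : Type*} [NormedAddCommGroup H] [NormedSpace ℝ H]
variable {E : Type*} [NormedAddCommGroup E] [NormedSpace ℝ E]
variable {F : Type*} [NormedAddCommGroup F] [NormedSpace ℝ F]
variable {p q : ℕ∞} {X : Opens G} {Y : Opens H} {T : CDiff p X E →ₗ[ℝ] CDiff q Y F}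

theorem isOpen_nontrivialSet (T : CDiff p X E →ₗ[ℝ] CDiff q Y F) : IsOpen (nontrivialSet T) := by
  simp only [nontrivialSet, ofPred_exists]
  exact isOpen_iUnion fun f => isOpen_ne_fun (T f).continuous continuous_const

theorem exists_norm_derivAt_le_rho (hT : Continuous T) (L : Compacts Y) {l : ℕ}
    (hl : (l : ℕ∞) ≤ q) :
    ∃ (K : Compacts X) (k : {k : ℕ // (k : ℕ∞) ≤ p}) (C : NNReal),
      ∀ f, ∀ y ∈ L, ‖(T f).derivAt l y‖ ≤ C * CDiff.rho K k f := by
  have hcont : Continuous ((CDiff.rho L ⟨l, hl⟩ : Seminorm ℝ (CDiff q Y F)).comp T) :=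
    (CDiff.withSeminorms_rhoFamily.continuous_seminorm (L, ⟨l, hl⟩)).comp hT
  obtain ⟨s, C, -, hC⟩ := Seminorm.bound_of_continuous CDiff.withSeminorms_rhoFamily _ hcont
  have : Nonempty {k : ℕ // (k : ℕ∞) ≤ p} := ⟨0, zero_le⟩
  obtain ⟨⟨K, k⟩, hs⟩ := s.exists_le
  refine ⟨K, k, C, fun f y hy => (CDiff.norm_derivAt_le_rho (T f) le_rfl hy).trans <|
    (hC f).trans ?_⟩
  have hsup : s.sup (CDiff.rhoFamily p X E) ≤ CDiff.rho K k :=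
    Finset.sup_le fun i hi => CDiff.monotone_rhoFamily (hs i hi)
  exact mul_le_mul_of_nonneg_left (hsup f) C.2

/-- `x` is a support point of the functional `f ↦ T f y`: this functional kills every function
that vanishes near `x`. It is the value at `y` of a support map of `T` with values in `X`. -/
def IsSupportPoint (T : CDiff p X E →ₗ[ℝ] CDiff q Y F) (y : Y) (x : X) : Prop :=
  ∀ f : CDiff p X E, x ∉ tsupport (f : X → E) → T f y = 0

theorem exists_cutoff_apply_eq_zero (hb : HasBumpFunction p G) (hsep : IsSeparating T) {y : Y}
    {x : X} (hx : ¬IsSupportPoint T y x) :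
    ∃ ψ : CDiff p X ℝ, ψ =ᶠ[𝓝 x] 1 ∧ ∀ f : CDiff p X E, T (ψ • f) y = 0 := by
  simp only [IsSupportPoint, not_forall] at hx
  obtain ⟨f₀, hxf₀, hTf₀⟩ := hx
  obtain ⟨ψ, hone, hsupp⟩ := hb.exists_cutoff
    ((isClosed_tsupport (f₀ : X → E)).isOpen_compl.mem_nhds hxf₀)
  refine ⟨ψ, hone, fun f => (hsep (ψ • f) f₀ (fun z => ?_) y).resolve_right hTf₀⟩
  by_cases hz : z ∈ tsupport (f₀ : X → E)
  · left
    rw [CDiff.smul_apply, image_eq_zero_of_notMem_tsupport fun h => hsupp h hz, zero_smul]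
  · exact .inr (image_eq_zero_of_notMem_tsupport hz)

theorem exists_apply_eq_of_disjoint_tsupport (hb : HasBumpFunction p G) (hsep : IsSeparating T)
    {y : Y} (hno : ∀ x, ¬IsSupportPoint T y x) {K : Set X} (hK : IsCompact K)
    (f : CDiff p X E) :
    ∃ g : CDiff p X E, T g y = T f y ∧ tsupport (g : X → E) ⊆ tsupport (f : X → E) ∧
      Disjoint K (tsupport (g : X → E)) := by
  refine hK.induction_on (p := fun s => ∀ f : CDiff p X E, ∃ g : CDiff p X E,
    T g y = T f y ∧ tsupport (g : X → E) ⊆ tsupport (f : X → E) ∧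
      Disjoint s (tsupport (g : X → E))) (fun f => ?_) (fun s t hst ht f => ?_)
    (fun s t hs ht f => ?_) (fun x _ => ?_) f
  · exact ⟨f, rfl, Subset.rfl, empty_disjoint _⟩
  · obtain ⟨g, hTg, hgf, hgt⟩ := ht f
    exact ⟨g, hTg, hgf, hgt.mono_left hst⟩
  · obtain ⟨g₁, hT₁, hsub₁, hdisj₁⟩ := hs f
    obtain ⟨g₂, hT₂, hsub₂, hdisj₂⟩ := ht g₁
    exact ⟨g₂, hT₂.trans hT₁, hsub₂.trans hsub₁,
      disjoint_union_left.2 ⟨hdisj₁.mono_right hsub₂, hdisj₂⟩⟩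
  · obtain ⟨ψ, hone, hTψ⟩ := exists_cutoff_apply_eq_zero hb hsep (hno x)
    refine ⟨_, mem_nhdsWithin_of_mem_nhds (eventually_eventually_nhds.2 hone), fun f =>
      ⟨f - ψ • f, ?_, closure_mono fun z hz hfz => hz ?_, disjoint_left.2 fun z hz => ?_⟩⟩
    · rw [map_sub, CDiff.sub_apply, hTψ, sub_zero]
    · rw [CDiff.sub_apply, CDiff.smul_apply, hfz, smul_zero, sub_zero]
    · refine notMem_tsupport_iff_eventuallyEq.2 ?_
      filter_upwards [hz] with w hw
      rw [CDiff.sub_apply, CDiff.smul_apply, hw, Pi.one_apply, one_smul, sub_self, Pi.zero_apply]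

theorem exists_isSupportPoint (hb : HasBumpFunction p G) (hT : Continuous T)
    (hsep : IsSeparating T) {y : Y} (hy : y ∈ nontrivialSet T) : ∃ x, IsSupportPoint T y x := by
  by_contra! hno
  obtain ⟨K, k, C, hC⟩ := exists_norm_derivAt_le_rho hT ⟨{y}, isCompact_singleton⟩
    (l := 0) zero_le
  obtain ⟨f, hf⟩ := hy
  obtain ⟨g, hTg, -, hKg⟩ := exists_apply_eq_of_disjoint_tsupport hb hsep hno K.isCompact f
  have hbound := hC g y (mem_singleton y)
  rw [CDiff.norm_derivAt_zero, CDiff.rho_eq_zero_of_disjoint_tsupport k hKg, mul_zero,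
    norm_le_zero_iff, hTg] at hbound
  exact hf hbound

theorem IsSupportPoint.apply_smul {y : Y} {x : X} (hx : IsSupportPoint T y x)
    {ψ : CDiff p X ℝ} (hψ : ψ =ᶠ[𝓝 x] 1) (f : CDiff p X E) : T (ψ • f) y = T f y := by
  have hsub : T (ψ • f - f) y = 0 := by
    refine hx _ (notMem_tsupport_iff_eventuallyEq.2 ?_)
    filter_upwards [hψ] with z hz
    rw [CDiff.sub_apply, CDiff.smul_apply, hz, Pi.one_apply, one_smul, sub_self, Pi.zero_apply]
  rwa [map_sub, CDiff.sub_apply, sub_eq_zero] at hsub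

theorem IsSupportMap.eq_toCompactif (hb : HasBumpFunction p G)
    {k : nontrivialSet T → Compactif p X} (hk : IsSupportMap T k) {y : nontrivialSet T} {x : X}
    (hx : IsSupportPoint T y x) :
    k y = toCompactif p X x := by
  by_contra hne
  obtain ⟨V, U, hV, hU, hkV, hxU, hVU⟩ := t2_separation hne
  obtain ⟨ψ, hone, hsupp⟩ := hb.exists_cutoff
    ((hU.preimage (continuous_toCompactif p X)).mem_nhds hxU)
  obtain ⟨f, hf⟩ := y.2
  have hky : k y ∈ closedSupport (ψ • f) := by
    by_contra hky
    exact hf ((hx.apply_smul hone f).symm.trans (hk.eq_zero _ y hky))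
  obtain ⟨_, hzV, z, hz, rfl⟩ := mem_closure_iff.1 hky V hV hkV
  exact disjoint_left.1 hVU hzV (hsupp (subset_tsupport ψ (left_ne_zero_of_smul hz)))

theorem continuous_of_isSupportPoint (hb : HasBumpFunction p G) {h : nontrivialSet T → X}
    (hh : ∀ y : nontrivialSet T, IsSupportPoint T y (h y)) : Continuous h := by
  refine continuous_iff_continuousAt.2 fun y => tendsto_def.2 fun U hU => ?_
  obtain ⟨f, hf⟩ := y.2
  obtain ⟨ψ, hone, hsupp⟩ := hb.exists_cutoff hU
  have hne : T (ψ • f) y ≠ 0 := by rwa [(hh y).apply_smul hone]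
  have hcont : Continuous fun w : nontrivialSet T => T (ψ • f) w :=
    (T (ψ • f)).continuous.comp continuous_subtype_val
  filter_upwards [hcont.continuousAt.eventually_ne hne] with w hw
  exact hsupp (tsupport_smul_subset_left ψ f (not_imp_comm.1 (hh w (ψ • f)) hw))

theorem isSupportMap_of_isSupportPoint {h : nontrivialSet T → X} (hcont : Continuous h)
    (hh : ∀ y : nontrivialSet T, IsSupportPoint T y (h y)) :
    IsSupportMap T (fun y => toCompactif p X (h y)) where
  continuous := (continuous_toCompactif p X).comp hcont
  eq_zero f y hy := hh y f fun hmem => hy <|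
    image_closure_subset_closure_image (continuous_toCompactif p X) (mem_image_of_mem _ hmem)

theorem notMem_tsupport_apply {h : nontrivialSet T → X} (hcont : Continuous h)
    (hh : ∀ y : nontrivialSet T, IsSupportPoint T y (h y)) {f : CDiff p X E} {w : nontrivialSet T}
    (hw : h w ∉ tsupport (f : X → E)) : (w : Y) ∉ tsupport (T f : Y → F) := by
  rw [notMem_tsupport_iff_eventuallyEq, EventuallyEq,
    ← (isOpen_nontrivialSet T).isOpenEmbedding_subtypeVal.map_nhds_eq w, eventually_map]
  filter_upwards [hcont.continuousAt.eventually
    ((isClosed_tsupport (f : X → E)).isOpen_compl.mem_nhds hw)] with v hv using hh v f hv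

theorem IsSupportPoint.exists_norm_mul_pow_le (hb : HasBumpFunction p G) {L : Compacts Y}
    {K : Compacts X} {k : {k : ℕ // (k : ℕ∞) ≤ p}} {l : ℕ} (hl : (l : ℕ∞) ≤ q) {C : NNReal}
    (hC : ∀ f, ∀ y ∈ L, ‖(T f).derivAt l y‖ ≤ C * CDiff.rho K k f) {y : Y} {x : X}
    (hx : IsSupportPoint T y x) (f : CDiff p X E) :
    ∃ C' : ℝ, ∀ (w : Y) (r : ℝ), segment ℝ (w : H) y ⊆ (↑) '' (L : Set Y) → 0 < r → r ≤ 1 →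
      (∀ g : CDiff p X E, tsupport (g : X → E) ⊆ Metric.closedBall x r →
        w ∉ tsupport (T g : Y → F)) →
      ‖T f y‖ * r ^ k.1 ≤ C' * dist w y ^ l := by
  obtain ⟨B, hB⟩ := hb.exists_cutoff_rho_le (X := X) k
  refine ⟨C * (2 ^ k.1 * B * CDiff.rho K k f), fun w r hwy hr hr₁ hw => ?_⟩
  obtain ⟨ψ, hone, hsupp, hrho⟩ := hB x r hr
  have hderiv : ∀ z ∈ L, ‖(T (ψ • f)).derivAt l z‖ ≤
      C * (2 ^ k.1 * (B * r⁻¹ ^ k.1) * CDiff.rho K k f) := fun z hz =>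
    (hC _ z hz).trans <| by
      gcongr
      refine (CDiff.rho_smul_le K k ψ f).trans ?_
      gcongr
      exact hrho hr₁ K
  have htaylor := CDiff.norm_le_of_notMem_tsupport (T (ψ • f)) hl
    (hw _ ((tsupport_smul_subset_left ψ f).trans hsupp)) hwy hderiv
  rw [hx.apply_smul hone, ← dist_eq_norm, ← Subtype.dist_eq, dist_comm] at htaylor
  calc ‖T f y‖ * r ^ k.1
      ≤ C * (2 ^ k.1 * (B * r⁻¹ ^ k.1) * CDiff.rho K k f) * dist w y ^ l * r ^ k.1 := by gcongr
    _ = C * (2 ^ k.1 * B * CDiff.rho K k f) * dist w y ^ l := by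
      rw [inv_pow]
      field_simp

theorem eventually_dist_pow_le (hb : HasBumpFunction p G) {h : nontrivialSet T → X}
    (hh : ∀ y : nontrivialSet T, IsSupportPoint T y (h y)) {L : Compacts Y} {K : Compacts X}
    {k : {k : ℕ // (k : ℕ∞) ≤ p}} {l : ℕ} (hl : (l : ℕ∞) ≤ q) {C : NNReal}
    (hC : ∀ f, ∀ y ∈ L, ‖(T f).derivAt l y‖ ≤ C * CDiff.rho K k f) (y : nontrivialSet T) :
    ∃ C' : ℝ, ∀ᶠ w : nontrivialSet T in 𝓝 y, segment ℝ (w : H) y ⊆ (↑) '' (L : Set Y) → h w ≠ h y →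
      dist (h w) (h y) ^ k.1 ≤ C' * dist w y ^ l := by
  have hcont := continuous_of_isSupportPoint hb hh
  obtain ⟨f, hf⟩ := y.2
  obtain ⟨C', hC'⟩ := (hh y).exists_norm_mul_pow_le hb hl hC f
  refine ⟨2 ^ k.1 * C' / ‖T f y‖, ?_⟩
  filter_upwards [hcont.continuousAt.eventually (Metric.ball_mem_nhds (h y) one_pos)]
    with w hw hwy hne
  have hd : 0 < dist (h w) (h y) := dist_pos.2 hne
  have hfar : ∀ g : CDiff p X E,
      tsupport (g : X → E) ⊆ Metric.closedBall (h y) (dist (h w) (h y) / 2) →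
        (w : Y) ∉ tsupport (T g : Y → F) := fun g hg =>
    notMem_tsupport_apply hcont hh fun hmem => (half_lt_self hd).not_ge (hg hmem)
  have hbound := hC' w _ hwy (half_pos hd) (by linarith [Metric.mem_ball.1 hw]) hfar
  rw [div_pow, mul_div_assoc', div_le_iff₀ (by positivity)] at hbound
  rw [div_mul_eq_mul_div, le_div_iff₀ (norm_pos_iff.2 hf), Subtype.dist_eq w y]
  linarith

theorem isLocallyConstant_of_isSupportPoint {n : ℕ} (hb : HasBumpFunction n G)
    (hnq : (n : ℕ∞) < q) {T : CDiff n X E →ₗ[ℝ] CDiff q Y F} (hT : Continuous T)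
    {h : nontrivialSet T → X} (hh : ∀ y : nontrivialSet T, IsSupportPoint T y (h y)) :
    IsLocallyConstant h := by
  have he : IsOpenEmbedding fun y : nontrivialSet T => (y : H) :=
    Y.isOpen.isOpenEmbedding_subtypeVal.comp (isOpen_nontrivialSet T).isOpenEmbedding_subtypeVal
  refine IsLocallyConstant.desc h ((↑) : X → G) ?_ Subtype.val_injective
  refine isLocallyConstant_of_dist_pow_le_on_segments he n.lt_succ_self fun a b hab => ?_
  have habY : segment ℝ a b ⊆ range ((↑) : Y → H) := fun z hz =>
    let ⟨y, hy⟩ := hab hz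
    ⟨y, hy⟩
  have hcomp : IsCompact (segment ℝ a b) := by
    rw [segment_eq_image_lineMap]
    exact isCompact_Icc.image AffineMap.lineMap_continuous
  let L : Compacts Y := ⟨(↑) ⁻¹' segment ℝ a b,
    Topology.IsInducing.subtypeVal.isCompact_preimage' hcomp habY⟩
  have hn : ((n + 1 : ℕ) : ℕ∞) ≤ q := by exact_mod_cast Order.add_one_le_of_lt hnq
  obtain ⟨K, k, C, hC⟩ := exists_norm_derivAt_le_rho hT L hn
  have hCn : ∀ f, ∀ y ∈ L, ‖(T f).derivAt (n + 1) y‖ ≤ C * CDiff.rho K ⟨n, le_rfl⟩ f :=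
    fun f y hy => (hC f y hy).trans <| by
      gcongr
      exact CDiff.monotone_rhoFamily (a := (K, k)) (b := (K, ⟨n, le_rfl⟩))
        ⟨le_rfl, Nat.cast_le.1 k.2⟩ f
  choose C' hC' using eventually_dist_pow_le hb hh hn hCn
  refine ⟨C', fun y hy => (hC' y).mono fun w hw hwab hne => hw ?_ (ne_of_apply_ne _ hne)⟩
  rw [show ((↑) : Y → H) '' (L : Set Y) = segment ℝ a b from image_preimage_eq_of_subset habY]
  exact (convex_segment a b).segment_subset hwab hy

end SupportPoint

theorem corollary13_general
    {G : Type*} [NormedAddCommGroup G] [NormedSpace ℝ G]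
    {H : Type*} [NormedAddCommGroup H] [NormedSpace ℝ H]
    {E : Type*} [NormedAddCommGroup E] [NormedSpace ℝ E]
    {F : Type*} [NormedAddCommGroup F] [NormedSpace ℝ F]
    {X : Opens G} {Y : Opens H} {p q : ℕ∞} (hpq : p < q) (hbump : HasBumpFunction p G)
    {T : CDiff p X E →ₗ[ℝ] CDiff q Y F} (hcont : Continuous T) (hsep : IsSeparating T) :
    ∃ h : nontrivialSet T → X, IsLocallyConstant h ∧
      IsSupportMap T (fun y => toCompactif p X (h y)) ∧
      ∀ k : nontrivialSet T → Compactif p X, IsSupportMap T k →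
        k = fun y => toCompactif p X (h y) := by
  lift p to ℕ using ne_top_of_lt hpq
  choose h hh using fun y : nontrivialSet T => exists_isSupportPoint hbump hcont hsep y.2
  exact ⟨h, isLocallyConstant_of_isSupportPoint hbump hpq hcont hh,
    isSupportMap_of_isSupportPoint (continuous_of_isSupportPoint hbump hh) hh,
    fun k hk => funext fun y => hk.eq_toCompactif hbump (hh y)⟩

theorem corollary13
    {G : Type*} [NormedAddCommGroup G] [NormedSpace ℝ G] [CompleteSpace G]
    {H : Type*} [NormedAddCommGroup H] [NormedSpace ℝ H] [CompleteSpace H]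
    {E : Type*} [NormedAddCommGroup E] [NormedSpace ℝ E] [CompleteSpace E]
    {F : Type*} [NormedAddCommGroup F] [NormedSpace ℝ F] [CompleteSpace F]
    (X : TopologicalSpace.Opens G) (Y : TopologicalSpace.Opens H)
    (p q : ℕ∞) (hp : 1 ≤ p) (hpq : p < q)
    (hbump : HasBumpFunction p G)
    (T : CDiff p X E →ₗ[ℝ] CDiff q Y F) (hcont : Continuous T)
    (hsep : IsSeparating T) (hnt : IsNowhereTrivial T) :
    ∃ h : Y → X,
      IsSupportMap T (fun y => toCompactif p X (h y.1)) ∧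
      (∀ k : nontrivialSet T → Compactif p X, IsSupportMap T k →
        k = fun y => toCompactif p X (h y.1)) ∧
      ∃ P : Set (Set Y), Setoid.IsPartition P ∧
        ∀ s ∈ P, IsClopen s ∧ ∃ x : X, ∀ y ∈ s, h y = x := by
  obtain ⟨h, hconst, hsupp, huniq⟩ := corollary13_general hpq hbump hcont hsep
  exact ⟨fun y => h ⟨y, hnt y⟩, hsupp, huniq,
    exists_isPartition_isClopen_of_isLocallyConstant (hconst.comp_continuous (by fun_prop))⟩
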